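/- A metric surface is a metric space $X$ together with a homeomorphism $\varphi\colon X\to M$ onto a compact connected smooth $2$-manifold $M$ with possibly non-empty boundary; its boundary is $\partial X:=\varphi^{-1}(\partial M)$. Write $B(x,r)$ for open balls. A metric space $X$ is Ahlfors $2$-regular if there is $K>0$ such that $K^{-1}r^2\le \mathcal H^2_X(B(x,r))\le K r^2$ for all $x\in X$ and $0<r<\operatorname{diam}X$, where $\mathcal H^2_X$ is the $2$-dimensional Hausdorff measure. It is linearly locally connected (LLC) if there is $\lambda\ge 1$ such that for all $x\in X$ and $r>0$, any two distinct points of $B(x,r)$ lie in a continuum (a compact connected set) contained in $B(x,\lambda r)$, and any two distinct points of $X\setminus B(x,r)$ lie in a continuum contained in $X\setminus B(x,r/\lambda)$. Let $(X,d_X)$ and $(Y,d_Y)$ be metric surfaces with non-empty boundary, let $A\subset\partial X$ and $B\subset\partial Y$ be connected components of the boundaries, and let $\gamma\colon A\to B$ be a biLipschitz homeomorphism. Let $$\widehat{XY}:=(X\sqcup Y)/\sim$$ where $\sim$ is the equivalence relation generated by $a\sim\gamma(a)$ for $a\in A$. Let $d$ be the extended metric on $X\sqcup Y$ that equals $d_X$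 on $X$, $d_Y$ on $Y$, and $\infty$ between points of different pieces. Define $$\hat d(a,b):=\inf \sum_{i=0}^{n} d(p_i,q_i),$$ where the infimum is over all $n\ge 0$ and all $p_0,q_0,\dots,p_n,q_n\in X\sqcup Y$ such that $p_0$ represents $a$, $q_n$ represents $b$, and $q_i\sim p_{i+1}$ for $0\le i<n$. If $(X,d_X)$ and $(Y,d_Y)$ are Ahlfors $2$-regular and LLC, then $\hat d$ is a (finite) metric on $\widehat{XY}$, and $(\widehat{XY},\hat d)$ is Ahlfors $2$-regular and LLC. -/

import Mathlib

open scoped ENNReal NNReal Manifold ContDiff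

noncomputable section

/-- The two-dimensional Hausdorff measure of a metric space, normalized so that it agrees with
Lebesgue measure on the Euclidean plane. (Mathlib's `μH[2]` weights a covering set by the square
of its diameter, which gives the Euclidean unit disc the measure `4` instead of `π`.) -/
def hausdorffTwo (X : Type*) [MetricSpace X] (A : Set X) : ℝ≥0∞ :=
  ENNReal.ofReal (Real.pi / 4) *
    (letI : MeasurableSpace X := borel X
     haveI : BorelSpace X := ⟨rfl⟩
     (MeasureTheory.Measure.hausdorffMeasure 2 : MeasureTheory.Measure X) A)

/-- Ahlfors `2`-regularity. The diameter is taken in `[0, ∞]`. -/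
def IsAhlforsTwoRegular (X : Type*) [MetricSpace X] : Prop :=
  ∃ K : ℝ, 0 < K ∧ ∀ (x : X) (r : ℝ), 0 < r →
    ENNReal.ofReal r < Metric.ediam (Set.univ : Set X) →
    ENNReal.ofReal (K⁻¹ * r ^ 2) ≤ hausdorffTwo X (Metric.ball x r) ∧
      hausdorffTwo X (Metric.ball x r) ≤ ENNReal.ofReal (K * r ^ 2)

/-- The points `p` and `q` can be connected by a continuum (a compact connected set)
inside `S`. -/
def JoinedByContinuumIn {X : Type*} [TopologicalSpace X] (S : Set X) (p q : X) : Prop :=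
  ∃ E : Set X, IsCompact E ∧ IsConnected E ∧ p ∈ E ∧ q ∈ E ∧ E ⊆ S

/-- Linear local connectedness. -/
def IsLLC (X : Type*) [MetricSpace X] : Prop :=
  ∃ l : ℝ, 1 ≤ l ∧ ∀ (x : X) (r : ℝ), 0 < r →
    (∀ p ∈ Metric.ball x r, ∀ q ∈ Metric.ball x r, p ≠ q →
      JoinedByContinuumIn (Metric.ball x (l * r)) p q) ∧
    (∀ p ∈ (Metric.ball x r)ᶜ, ∀ q ∈ (Metric.ball x r)ᶜ, p ≠ q →
      JoinedByContinuumIn (Metric.ball x (r / l))ᶜ p q)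

/-- The boundary of a space `X` that is identified with a smooth surface with boundary `M` by
a homeomorphism `φ`: the points that correspond to boundary points of `M`. -/
def surfaceBoundary {X M : Type*} [TopologicalSpace X] [TopologicalSpace M]
    [ChartedSpace (EuclideanHalfSpace 2) M] (φ : X ≃ₜ M) : Set X :=
  φ ⁻¹' (𝓡∂ 2).boundary M

/-- `A` is a connected component of the subset `S`. -/
def IsComponentOf {X : Type*} [TopologicalSpace X] (A S : Set X) : Prop :=
  ∃ p ∈ S, A = connectedComponentIn S p

/-- The extended distance of the disjoint union: points of different pieces are at infinite
distance. -/
def disjointUnionEDist {X Y : Type*} [MetricSpace X] [MetricSpace Y] :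
    X ⊕ Y → X ⊕ Y → ℝ≥0∞
  | Sum.inl x, Sum.inl x' => edist x x'
  | Sum.inr y, Sum.inr y' => edist y y'
  | _, _ => ⊤

/-- The quotient of the disjoint union of `X` and `Y` by the equivalence relation generated by
`a ∼ γ a` for `a ∈ A`. -/
def GluedSpace {X Y : Type*} {A : Set X} {B : Set Y} (γ : A → B) : Type _ :=
  Quot (fun s t : X ⊕ Y => ∃ a : A, s = Sum.inl (a : X) ∧ t = Sum.inr (γ a : Y))

/-- The quotient map onto the glued space. -/
def GluedSpace.mk {X Y : Type*} {A : Set X} {B : Set Y} (γ : A → B) (s : X ⊕ Y) :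
    GluedSpace γ :=
  Quot.mk _ s

/-- The quotient semi-metric: the infimum of the sums `d(p₀, q₀) + … + d(pₙ, qₙ)` over all finite
chains in the disjoint union for which `p₀` represents `a`, `qₙ` represents `b`, and each `qᵢ` is
equivalent to `pᵢ₊₁`. -/
def quotientEDist {X Y : Type*} [MetricSpace X] [MetricSpace Y] {A : Set X} {B : Set Y}
    (γ : A → B) (a b : GluedSpace γ) : ℝ≥0∞ :=
  ⨅ (n : ℕ) (p : ℕ → X ⊕ Y) (q : ℕ → X ⊕ Y)
    (_ : GluedSpace.mk γ (p 0) = a ∧ GluedSpace.mk γ (q n) = b ∧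
      ∀ i < n, GluedSpace.mk γ (q i) = GluedSpace.mk γ (p (i + 1))),
    ∑ i ∈ Finset.range (n + 1), disjointUnionEDist (p i) (q i)

end

/-! Let `L ≥ 1` be a biLipschitz constant of `γ`. Each piece embeds in the glued space by a
`1`-Lipschitz map whose inverse is `L`-Lipschitz, and up to the factor `L` a distance between
different pieces is realized through a single glued point. The lower bounds on the quotient distance
come from test functions: the distance from a point, divided by `L`, extends over the other piece to
a function that descends to the quotient and is `1`-Lipschitz there, so no chain can be shorter than
its increment (`le_add_quotientEDist`). These metric facts are recorded in `IsBilipschitzGluing`,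
and the rest uses nothing else about the quotient. Ahlfors regularity transfers because biLipschitz
maps distort `ℋ²` by bounded factors. For LLC, points inside a ball are joined through its centre,
and points outside through a glued point that avoids a comparable smaller ball. Such a glued point
exists because a boundary component has at least two points. -/

/-! ### The quotient distance and its comparison with the distances of the pieces -/

section QuotientMetric

theorem GluedSpace.mk_surjective {X Y : Type*} {A : Set X} {B : Set Y} (γ : A → B) :
    Function.Surjective (GluedSpace.mk γ) :=
  Quot.mk_surjective

theorem GluedSpace.mk_inl_eq_mk_inr {X Y : Type*} {A : Set X} {B : Set Y} (γ : A → B) (a : A) :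
    GluedSpace.mk γ (Sum.inl (a : X)) = GluedSpace.mk γ (Sum.inr (γ a : Y)) :=
  Quot.sound ⟨a, rfl, rfl⟩

variable {X Y : Type*} [MetricSpace X] [MetricSpace Y]

theorem disjointUnionEDist_self (s : X ⊕ Y) : disjointUnionEDist s s = 0 := by
  cases s <;> simp [disjointUnionEDist]

theorem disjointUnionEDist_comm (s t : X ⊕ Y) :
    disjointUnionEDist s t = disjointUnionEDist t s := by
  cases s <;> cases t <;> simp [disjointUnionEDist, edist_comm]

variable {A : Set X} {B : Set Y}

theorem quotientEDist_mk_le (γ : A → B) (s t : X ⊕ Y) :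
    quotientEDist γ (GluedSpace.mk γ s) (GluedSpace.mk γ t) ≤ disjointUnionEDist s t := by
  refine iInf_le_of_le 0 <| iInf_le_of_le (fun _ => s) <| iInf_le_of_le (fun _ => t) <|
    iInf_le_of_le ⟨rfl, rfl, by simp⟩ ?_
  simp

theorem quotientEDist_self (γ : A → B) (a : GluedSpace γ) : quotientEDist γ a a = 0 := by
  obtain ⟨s, rfl⟩ := GluedSpace.mk_surjective γ a
  exact le_antisymm ((quotientEDist_mk_le γ s s).trans_eq (disjointUnionEDist_self s)) zero_le

theorem quotientEDist_comm_le (γ : A → B) (a b : GluedSpace γ) :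
    quotientEDist γ b a ≤ quotientEDist γ a b := by
  refine le_iInf fun n => le_iInf fun p => le_iInf fun q => le_iInf fun h => ?_
  obtain ⟨ha, hb, hpq⟩ := h
  refine iInf_le_of_le n <| iInf_le_of_le (fun i => q (n - i)) <|
    iInf_le_of_le (fun i => p (n - i)) <| iInf_le_of_le ⟨by simpa, by simpa, ?_⟩ ?_
  · intro i hi
    have := hpq (n - (i + 1)) (by omega)
    rw [show n - (i + 1) + 1 = n - i by omega] at this
    exact this.symm
  · rw [← Finset.sum_range_reflect]
    refine (Finset.sum_congr rfl fun i hi => ?_).le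
    rw [Finset.mem_range] at hi
    simp only [show n - (n + 1 - 1 - i) = i by omega]
    exact disjointUnionEDist_comm _ _

theorem quotientEDist_comm (γ : A → B) (a b : GluedSpace γ) :
    quotientEDist γ a b = quotientEDist γ b a :=
  le_antisymm (quotientEDist_comm_le γ b a) (quotientEDist_comm_le γ a b)

theorem quotientEDist_triangle (γ : A → B) (a b c : GluedSpace γ) :
    quotientEDist γ a c ≤ quotientEDist γ a b + quotientEDist γ b c := by
  have key : ∀ (n : ℕ) (p q : ℕ → X ⊕ Y)
      (_ : GluedSpace.mk γ (p 0) = a ∧ GluedSpace.mk γ (q n) = b ∧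
        ∀ i < n, GluedSpace.mk γ (q i) = GluedSpace.mk γ (p (i + 1)))
      (m : ℕ) (p' q' : ℕ → X ⊕ Y)
      (_ : GluedSpace.mk γ (p' 0) = b ∧ GluedSpace.mk γ (q' m) = c ∧
        ∀ i < m, GluedSpace.mk γ (q' i) = GluedSpace.mk γ (p' (i + 1))),
      quotientEDist γ a c ≤ ∑ i ∈ Finset.range (n + 1), disjointUnionEDist (p i) (q i) +
        ∑ i ∈ Finset.range (m + 1), disjointUnionEDist (p' i) (q' i) := by
    rintro n p q ⟨ha, hb, hpq⟩ m p' q' ⟨hb', hc, hpq'⟩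
    -- Chains are concatenated: the first occupies the indices `0, …, n`, the second is shifted by
    -- `n + 1`.
    refine iInf_le_of_le (n + 1 + m) <|
      iInf_le_of_le (fun i => if i ≤ n then p i else p' (i - (n + 1))) <|
      iInf_le_of_le (fun i => if i ≤ n then q i else q' (i - (n + 1))) <|
      iInf_le_of_le ⟨by simpa, ?_, ?_⟩ ?_
    · simpa [show ¬ n + 1 + m ≤ n by omega] using hc
    · intro i hi
      rcases lt_trichotomy i n with h | rfl | h
      · simpa [h.le, Nat.succ_le_iff.2 h] using hpq i h
      · simpa using hb.trans hb'.symm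
      · have := hpq' (i - (n + 1)) (by omega)
        rw [show i - (n + 1) + 1 = i + 1 - (n + 1) by omega] at this
        simpa [show ¬ i ≤ n by omega, show ¬ i + 1 ≤ n by omega] using this
    · rw [show n + 1 + m + 1 = (n + 1) + (m + 1) by ring, Finset.sum_range_add]
      refine add_le_add (Finset.sum_congr rfl fun i hi => ?_).le
        (Finset.sum_congr rfl fun i _ => ?_).le
      · rw [Finset.mem_range] at hi
        simp [show i ≤ n by omega]
      · simp [show ¬ n + 1 + i ≤ n by omega]
  conv_rhs => rw [quotientEDist, quotientEDist]
  simp only [ENNReal.iInf_add, ENNReal.add_iInf]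
  exact le_iInf fun m => le_iInf fun p' => le_iInf fun q' => le_iInf fun h' =>
    le_iInf fun n => le_iInf fun p => le_iInf fun q => le_iInf fun h =>
      key _ _ _ h _ _ _ h'

/-- A function on the glued space that is `1`-Lipschitz on each piece is `1`-Lipschitz. -/
theorem le_add_quotientEDist (γ : A → B) (f : GluedSpace γ → ℝ≥0∞)
    (hf : ∀ s t, f (GluedSpace.mk γ t) ≤ f (GluedSpace.mk γ s) + disjointUnionEDist s t)
    (a b : GluedSpace γ) : f b ≤ f a + quotientEDist γ a b := by
  simp only [quotientEDist, ENNReal.add_iInf]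
  refine le_iInf fun n => le_iInf fun p => le_iInf fun q => le_iInf fun ⟨ha, hb, hpq⟩ => ?_
  subst ha hb
  induction n with
  | zero => simpa using hf (p 0) (q 0)
  | succ n ih =>
    rw [Finset.sum_range_succ, ← add_assoc]
    refine (hf (p (n + 1)) (q (n + 1))).trans (add_le_add_left ?_ _)
    rw [← hpq n n.lt_succ_self]
    have hpq' := fun i (hi : i < n) => hpq i (hi.trans n.lt_succ_self)
    exact ih hpq' ⟨rfl, rfl, hpq'⟩

/-- The extension to the glued space of the distance from `x`, shrunk by the factor `L`. -/
noncomputable def distFromLeft (γ : A → B) (L : ℝ≥0) (x : X) : X ⊕ Y → ℝ≥0∞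
  | Sum.inl x' => edist x x' / L
  | Sum.inr y => ⨅ a : A, edist x a / L + edist (γ a : Y) y

/-- The extension to the glued space of the distance from `y`, shrunk by the factor `L`. -/
noncomputable def distFromRight (γ : A → B) (L : ℝ≥0) (y : Y) : X ⊕ Y → ℝ≥0∞
  | Sum.inl x => ⨅ a : A, edist y (γ a) / L + edist (a : X) x
  | Sum.inr y' => edist y y' / L

theorem edist_div_le_add {Z : Type*} [PseudoEMetricSpace Z] (L : ℝ≥0) (x y z : Z) :
    edist x z / L ≤ edist x y / L + edist y z / L := by
  rw [← ENNReal.add_div]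
  exact ENNReal.div_le_div_right (edist_triangle _ _ _) _

variable {γ : A → B} {L : ℝ≥0}

/-- Dividing by `L` makes moving inside `A` no more expensive than moving inside `B`, so no detour
through another glued point beats the direct value at `a`. Hence the function descends to the
quotient. -/
theorem distFromLeft_compatible (hL : 1 ≤ L) (hγ : AntilipschitzWith L γ) (x : X) (a : A) :
    distFromLeft γ L x (Sum.inl (a : X)) = distFromLeft γ L x (Sum.inr (γ a : Y)) := by
  have hL0 : (L : ℝ≥0∞) ≠ 0 := by exact_mod_cast (zero_lt_one.trans_le hL).ne'
  refine le_antisymm (le_iInf fun a' => ?_) ((iInf_le _ a).trans (by simp [distFromLeft]))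
  refine (edist_div_le_add L x a' a).trans (add_le_add_right ?_ _)
  rw [ENNReal.div_le_iff_le_mul (.inl hL0) (.inl ENNReal.coe_ne_top), mul_comm]
  exact hγ a' a

theorem distFromRight_compatible (hL : 1 ≤ L) (hγ : LipschitzWith L γ) (y : Y) (a : A) :
    distFromRight γ L y (Sum.inl (a : X)) = distFromRight γ L y (Sum.inr (γ a : Y)) := by
  have hL0 : (L : ℝ≥0∞) ≠ 0 := by exact_mod_cast (zero_lt_one.trans_le hL).ne'
  refine le_antisymm ((iInf_le _ a).trans (by simp [distFromRight])) (le_iInf fun a' => ?_)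
  refine (edist_div_le_add L y (γ a') (γ a)).trans (add_le_add_right ?_ _)
  rw [ENNReal.div_le_iff_le_mul (.inl hL0) (.inl ENNReal.coe_ne_top), mul_comm]
  exact hγ a' a

theorem edist_div_le_self {Z : Type*} [PseudoEMetricSpace Z] (hL : 1 ≤ L) (x y : Z) :
    edist x y / L ≤ edist x y :=
  ENNReal.div_le_of_le_mul (le_mul_of_one_le_right' (by exact_mod_cast hL))

theorem distFromLeft_le (hL : 1 ≤ L) (x : X) (s t : X ⊕ Y) :
    distFromLeft γ L x t ≤ distFromLeft γ L x s + disjointUnionEDist s t := by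
  rcases s with s | s <;> rcases t with t | t
  · exact (edist_div_le_add L x s t).trans (add_le_add_right (edist_div_le_self hL s t) _)
  · simp [disjointUnionEDist]
  · simp [disjointUnionEDist]
  · simp only [distFromLeft, disjointUnionEDist, ENNReal.iInf_add]
    refine iInf_mono fun a => ?_
    rw [add_assoc]
    exact add_le_add_right (edist_triangle _ _ _) _

theorem distFromRight_le (hL : 1 ≤ L) (y : Y) (s t : X ⊕ Y) :
    distFromRight γ L y t ≤ distFromRight γ L y s + disjointUnionEDist s t := by
  rcases s with s | s <;> rcases t with t | t
  · simp only [distFromRight, disjointUnionEDist, ENNReal.iInf_add]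
    refine iInf_mono fun a => ?_
    rw [add_assoc]
    exact add_le_add_right (edist_triangle _ _ _) _
  · simp [disjointUnionEDist]
  · simp [disjointUnionEDist]
  · exact (edist_div_le_add L y s t).trans (add_le_add_right (edist_div_le_self hL s t) _)

/-- The descended function is `1`-Lipschitz and vanishes at the class of `x`. -/
theorem distFromLeft_le_quotientEDist (hL : 1 ≤ L) (hγ : AntilipschitzWith L γ) (x : X)
    (t : X ⊕ Y) :
    distFromLeft γ L x t ≤ quotientEDist γ (GluedSpace.mk γ (Sum.inl x)) (GluedSpace.mk γ t) := by
  have h := le_add_quotientEDist γ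
    (Quot.lift (distFromLeft γ L x) (by
      rintro _ _ ⟨a, rfl, rfl⟩
      exact distFromLeft_compatible hL hγ x a))
    (distFromLeft_le hL x) (GluedSpace.mk γ (Sum.inl x)) (GluedSpace.mk γ t)
  refine h.trans_eq ?_
  simp [GluedSpace.mk, distFromLeft]

theorem distFromRight_le_quotientEDist (hL : 1 ≤ L) (hγ : LipschitzWith L γ) (y : Y)
    (t : X ⊕ Y) :
    distFromRight γ L y t ≤ quotientEDist γ (GluedSpace.mk γ (Sum.inr y)) (GluedSpace.mk γ t) := by
  have h := le_add_quotientEDist γ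
    (Quot.lift (distFromRight γ L y) (by
      rintro _ _ ⟨a, rfl, rfl⟩
      exact distFromRight_compatible hL hγ y a))
    (distFromRight_le hL y) (GluedSpace.mk γ (Sum.inr y)) (GluedSpace.mk γ t)
  refine h.trans_eq ?_
  simp [GluedSpace.mk, distFromRight]

theorem edist_le_mul_quotientEDist_inl (hL : 1 ≤ L) (hγ : AntilipschitzWith L γ) (x x' : X) :
    edist x x' ≤
      L * quotientEDist γ (GluedSpace.mk γ (Sum.inl x)) (GluedSpace.mk γ (Sum.inl x')) := by
  have hL0 : (L : ℝ≥0∞) ≠ 0 := by exact_mod_cast (zero_lt_one.trans_le hL).ne'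
  rw [mul_comm, ← ENNReal.div_le_iff_le_mul (.inl hL0) (.inl ENNReal.coe_ne_top)]
  exact distFromLeft_le_quotientEDist hL hγ x (Sum.inl x')

theorem edist_le_mul_quotientEDist_inr (hL : 1 ≤ L) (hγ : LipschitzWith L γ) (y y' : Y) :
    edist y y' ≤
      L * quotientEDist γ (GluedSpace.mk γ (Sum.inr y)) (GluedSpace.mk γ (Sum.inr y')) := by
  have hL0 : (L : ℝ≥0∞) ≠ 0 := by exact_mod_cast (zero_lt_one.trans_le hL).ne'
  rw [mul_comm, ← ENNReal.div_le_iff_le_mul (.inl hL0) (.inl ENNReal.coe_ne_top)]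
  exact distFromRight_le_quotientEDist hL hγ y (Sum.inr y')

/-- Up to the factor `L`, the distance between points of different pieces is realized by a chain
through one glued point. -/
theorem exists_edist_add_edist_le (hL : 1 ≤ L) (hγ : AntilipschitzWith L γ) (hγc : Continuous γ)
    (hA : IsCompact A) (hA' : A.Nonempty) (x : X) (y : Y) :
    ∃ a : A, edist x a + edist (γ a : Y) y ≤
      L * quotientEDist γ (GluedSpace.mk γ (Sum.inl x)) (GluedSpace.mk γ (Sum.inr y)) := by
  have hL0 : (L : ℝ≥0∞) ≠ 0 := by exact_mod_cast (zero_lt_one.trans_le hL).ne'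
  have := isCompact_iff_compactSpace.1 hA
  have := hA'.to_subtype
  have hc : Continuous fun a : A => edist x a / L + edist (γ a : Y) y :=
    (ENNReal.continuous_div_const _ hL0 |>.comp (by fun_prop)).add (by fun_prop)
  -- Compactness of `A` turns the infimum in `distFromLeft` into a minimum.
  obtain ⟨a, -, ha⟩ := isCompact_univ.exists_isMinOn Set.univ_nonempty hc.continuousOn
  refine ⟨a, ?_⟩
  have h1 : edist x a / L + edist (γ a : Y) y ≤
      quotientEDist γ (GluedSpace.mk γ (Sum.inl x)) (GluedSpace.mk γ (Sum.inr y)) :=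
    le_trans (le_iInf fun a' => ha (Set.mem_univ a'))
      (distFromLeft_le_quotientEDist hL hγ x (Sum.inr y))
  refine le_trans ?_ (mul_le_mul_right h1 (L : ℝ≥0∞))
  rw [mul_add, ENNReal.mul_div_cancel hL0 ENNReal.coe_ne_top]
  exact add_le_add_right (le_mul_of_one_le_left' (by exact_mod_cast hL)) _

/-- Every point is at finite distance from one fixed glued point, which has representatives in both
pieces. -/
theorem quotientEDist_ne_top (hA : A.Nonempty) (a b : GluedSpace γ) :
    quotientEDist γ a b ≠ ⊤ := by
  obtain ⟨a₀, ha₀⟩ := hA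
  have key : ∀ c : GluedSpace γ,
      quotientEDist γ c (GluedSpace.mk γ (Sum.inl a₀)) ≠ ⊤ := by
    intro c
    obtain ⟨s | s, rfl⟩ := GluedSpace.mk_surjective γ c
    · exact ((quotientEDist_mk_le γ _ _).trans_lt (edist_lt_top s a₀)).ne
    · have : GluedSpace.mk γ (Sum.inl a₀) = _ := GluedSpace.mk_inl_eq_mk_inr γ ⟨a₀, ha₀⟩
      rw [this]
      exact ((quotientEDist_mk_le γ _ _).trans_lt (edist_lt_top s _)).ne
  refine ((quotientEDist_triangle γ a (GluedSpace.mk γ (Sum.inl a₀)) b).trans_lt ?_).ne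
  rw [quotientEDist_comm γ _ b]
  exact ENNReal.add_lt_top.2 ⟨(key a).lt_top, (key b).lt_top⟩

theorem eq_of_quotientEDist_eq_zero (hL : 1 ≤ L) (hγ : AntilipschitzWith L γ)
    (hγ' : LipschitzWith L γ) (hA : IsCompact A) (hA' : A.Nonempty) (a b : GluedSpace γ)
    (h : quotientEDist γ a b = 0) : a = b := by
  have cross : ∀ x y, quotientEDist γ (GluedSpace.mk γ (Sum.inl x))
      (GluedSpace.mk γ (Sum.inr y)) = 0 →
      GluedSpace.mk γ (Sum.inl x) = GluedSpace.mk γ (Sum.inr y) := by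
    intro x y h
    obtain ⟨a, ha⟩ := exists_edist_add_edist_le hL hγ hγ'.continuous hA hA' x y
    rw [h, mul_zero, nonpos_iff_eq_zero, add_eq_zero, edist_eq_zero, edist_eq_zero] at ha
    rw [ha.1, ← ha.2]
    exact GluedSpace.mk_inl_eq_mk_inr γ a
  obtain ⟨s | s, rfl⟩ := GluedSpace.mk_surjective γ a <;>
    obtain ⟨t | t, rfl⟩ := GluedSpace.mk_surjective γ b
  · have := edist_le_mul_quotientEDist_inl hL hγ s t
    rw [h, mul_zero, nonpos_iff_eq_zero, edist_eq_zero] at this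
    rw [this]
  · exact cross s t h
  · exact (cross t s (by rwa [quotientEDist_comm])).symm
  · have := edist_le_mul_quotientEDist_inr hL hγ' s t
    rw [h, mul_zero, nonpos_iff_eq_zero, edist_eq_zero] at this
    rw [this]

/-- The metric of the glued space. -/
@[reducible] noncomputable def gluedMetricSpace (hL : 1 ≤ L) (hγ : AntilipschitzWith L γ)
    (hγ' : LipschitzWith L γ) (hA : IsCompact A) (hA' : A.Nonempty) :
    MetricSpace (GluedSpace γ) :=
  letI : EMetricSpace (GluedSpace γ) :=
    { edist := quotientEDist γ
      edist_self := quotientEDist_self γ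
      edist_comm := quotientEDist_comm γ
      edist_triangle := quotientEDist_triangle γ
      eq_of_edist_eq_zero := fun {a b} h => eq_of_quotientEDist_eq_zero hL hγ hγ' hA hA' a b h }
  EMetricSpace.toMetricSpace (quotientEDist_ne_top hA')

theorem gluedMetricSpace_edist (hL : 1 ≤ L) (hγ : AntilipschitzWith L γ)
    (hγ' : LipschitzWith L γ) (hA : IsCompact A) (hA' : A.Nonempty) (a b : GluedSpace γ) :
    letI := gluedMetricSpace hL hγ hγ' hA hA'
    edist a b = quotientEDist γ a b := rfl

end QuotientMetric

/-! ### Boundary components are closed and nondegenerate -/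

section Boundary

theorem IsClosed.connectedComponentIn {X : Type*} [TopologicalSpace X] {F : Set X}
    (hF : IsClosed F) (p : X) : IsClosed (connectedComponentIn F p) := by
  by_cases hp : p ∈ F
  · refine isClosed_of_closure_subset ?_
    exact isPreconnected_connectedComponentIn.closure.subset_connectedComponentIn
      (subset_closure (mem_connectedComponentIn hp))
      (closure_minimal (connectedComponentIn_subset F p) hF)
  · rw [connectedComponentIn_eq_empty hp]
    exact isClosed_empty

variable {X M : Type*} [TopologicalSpace X] [TopologicalSpace M]
  [ChartedSpace (EuclideanHalfSpace 2) M] [IsManifold (𝓡∂ 2) ∞ M]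

theorem isClosed_surfaceBoundary (φ : X ≃ₜ M) : IsClosed (surfaceBoundary φ) :=
  (ModelWithCorners.isClosed_boundary (I := 𝓡∂ 2) (M := M) (n := ∞) (by simp)).preimage
    φ.continuous

/-- Every boundary point lies on a nondegenerate connected piece of the boundary. -/
theorem exists_ne_isPreconnected_subset_boundary (m : M)
    (hm : m ∈ (𝓡∂ 2).boundary M) :
    ∃ S : Set M, IsPreconnected S ∧ m ∈ S ∧ S ⊆ (𝓡∂ 2).boundary M ∧ ∃ m' ∈ S, m' ≠ m := by
  set e := extChartAt (𝓡∂ 2) m with he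
  set u := e m with hu
  have hu0 : u 0 = 0 := by
    have h : u ∈ frontier (Set.range (𝓡∂ 2)) := hm
    rw [frontier_range_modelWithCornersEuclideanHalfSpace] at h
    exact h.symm
  -- The half-space is cut out by coordinate `0`, so moving in coordinate `1` stays on its boundary
  -- line.
  let c : ℝ → EuclideanSpace ℝ (Fin 2) := fun t => u + t • EuclideanSpace.single 1 1
  have hc : Continuous c := by fun_prop
  have hc0 : c 0 = u := by simp [c]
  have hct (t : ℝ) : c t 0 = 0 := by simp [c, hu0]
  have hrange (t : ℝ) : c t ∈ Set.range (𝓡∂ 2) := by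
    rw [range_modelWithCornersEuclideanHalfSpace]
    exact (hct t).ge
  have htarget : ∀ᶠ t in nhds (0 : ℝ), c t ∈ e.target := by
    have h1 : e.target ∈ nhdsWithin u (Set.range (𝓡∂ 2)) := extChartAt_target_mem_nhdsWithin m
    have h2 : Filter.Tendsto c (nhds 0) (nhdsWithin u (Set.range (𝓡∂ 2))) :=
      tendsto_nhdsWithin_iff.2 ⟨hc0 ▸ hc.tendsto 0, .of_forall hrange⟩
    exact h2 h1
  obtain ⟨ε, hε, hball⟩ := Metric.eventually_nhds_iff_ball.1 htarget
  have hsymm0 : e.symm (c 0) = m := by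
    rw [hc0]
    exact extChartAt_to_inv m
  have h0 : (0 : ℝ) ∈ Metric.ball (0 : ℝ) ε := Metric.mem_ball_self hε
  refine ⟨(fun t => e.symm (c t)) '' Metric.ball 0 ε, ?_, ⟨0, h0, hsymm0⟩, ?_,
    e.symm (c (ε / 2)), ?_, ?_⟩
  · refine (convex_ball (0 : ℝ) ε).isPreconnected.image _ ?_
    exact (continuousOn_extChartAt_symm m).comp hc.continuousOn hball
  · rintro _ ⟨t, ht, rfl⟩
    have hsrc : e.symm (c t) ∈ (chartAt (EuclideanHalfSpace 2) m).source := by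
      rw [← extChartAt_source (𝓡∂ 2) m]
      exact e.map_target (hball t ht)
    -- For a smooth manifold, the boundary condition at a nearby point may be tested in the chart at
    -- `m`.
    refine (ModelWithCorners.isBoundaryPoint_iff_of_mem_atlas (n := ∞) (by simp)
      (chart_mem_atlas _ m) hsrc).2 ?_
    have hval : (chartAt (EuclideanHalfSpace 2) m).extend (𝓡∂ 2) (e.symm (c t)) = c t :=
      e.right_inv (hball t ht)
    rw [hval]
    refine ⟨subset_closure (hball t ht), fun hint => ?_⟩
    have := OpenPartialHomeomorph.interior_extend_target_subset_interior_range _ hint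
    rw [interior_range_modelWithCornersEuclideanHalfSpace] at this
    exact absurd (hct t) (ne_of_gt this)
  · exact ⟨ε / 2, by simp [abs_of_pos hε, hε], rfl⟩
  · intro h
    have h2 : c (ε / 2) = c 0 :=
      e.symm.injOn (hball _ (by simp [abs_of_pos hε, hε])) (hball 0 h0) (h.trans hsymm0.symm)
    have h3 := congrArg (fun v : EuclideanSpace ℝ (Fin 2) => v 1) h2
    simp [c, hε.ne'] at h3

theorem IsComponentOf.nontrivial_of_surfaceBoundary (φ : X ≃ₜ M) {A : Set X}
    (hA : IsComponentOf A (surfaceBoundary φ)) : A.Nontrivial := by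
  obtain ⟨p, hp, rfl⟩ := hA
  obtain ⟨S, hS, hpS, hSb, m', hm', hne⟩ := exists_ne_isPreconnected_subset_boundary (φ p) hp
  have hsub : φ.symm '' S ⊆ connectedComponentIn (surfaceBoundary φ) p := by
    refine (hS.image _ φ.symm.continuous.continuousOn).subset_connectedComponentIn
      ⟨φ p, hpS, φ.symm_apply_apply p⟩ ?_
    rintro _ ⟨s, hs, rfl⟩
    simpa [surfaceBoundary] using hSb hs
  refine ⟨φ.symm m', hsub ⟨m', hm', rfl⟩, p, mem_connectedComponentIn hp, fun h => hne ?_⟩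
  rw [← h, φ.apply_symm_apply]

theorem IsComponentOf.isClosed_of_surfaceBoundary (φ : X ≃ₜ M) {A : Set X}
    (hA : IsComponentOf A (surfaceBoundary φ)) : IsClosed A := by
  obtain ⟨p, -, rfl⟩ := hA
  exact (isClosed_surfaceBoundary φ).connectedComponentIn p

end Boundary

/-! ### Joining points by continua -/

section Continua

theorem JoinedByContinuumIn.refl {X : Type*} [TopologicalSpace X] {S : Set X} {p : X}
    (hp : p ∈ S) : JoinedByContinuumIn S p p :=
  ⟨{p}, isCompact_singleton, isConnected_singleton, rfl, rfl, Set.singleton_subset_iff.2 hp⟩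

theorem JoinedByContinuumIn.symm {X : Type*} [TopologicalSpace X] {S : Set X} {p q : X}
    (h : JoinedByContinuumIn S p q) : JoinedByContinuumIn S q p := by
  obtain ⟨E, hc, hconn, hp, hq, hS⟩ := h
  exact ⟨E, hc, hconn, hq, hp, hS⟩

theorem JoinedByContinuumIn.trans {X : Type*} [TopologicalSpace X] {S : Set X} {p q w : X}
    (h : JoinedByContinuumIn S p q) (h' : JoinedByContinuumIn S q w) :
    JoinedByContinuumIn S p w := by
  obtain ⟨E, hc, hconn, hp, hq, hS⟩ := h
  obtain ⟨F, hc', hconn', hq', hw, hS'⟩ := h'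
  exact ⟨E ∪ F, hc.union hc', hconn.union ⟨q, hq, hq'⟩ hconn', .inl hp, .inr hw,
    Set.union_subset hS hS'⟩

theorem JoinedByContinuumIn.image {X Z : Type*} [TopologicalSpace X] [TopologicalSpace Z]
    {S : Set X} {T : Set Z} {p q : X} (h : JoinedByContinuumIn S p q) {f : X → Z}
    (hf : Continuous f) (hST : Set.MapsTo f S T) : JoinedByContinuumIn T (f p) (f q) := by
  obtain ⟨E, hc, hconn, hp, hq, hS⟩ := h
  exact ⟨f '' E, hc.image hf, hconn.image f hf.continuousOn, ⟨p, hp, rfl⟩, ⟨q, hq, rfl⟩,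
    (hST.mono_left hS).image_subset⟩

theorem JoinedByContinuumIn.mono {X : Type*} [TopologicalSpace X] {S T : Set X} {p q : X}
    (h : JoinedByContinuumIn S p q) (hST : S ⊆ T) : JoinedByContinuumIn T p q := by
  obtain ⟨E, hc, hconn, hp, hq, hS⟩ := h
  exact ⟨E, hc, hconn, hp, hq, hS.trans hST⟩

/-- Linear local connectedness with a given constant, also for equal points. -/
def IsLLCWith (l : ℝ) (X : Type*) [MetricSpace X] : Prop :=
  ∀ (x : X) (r : ℝ), 0 < r →
    (∀ p ∈ Metric.ball x r, ∀ q ∈ Metric.ball x r,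
      JoinedByContinuumIn (Metric.ball x (l * r)) p q) ∧
    (∀ p ∈ (Metric.ball x r)ᶜ, ∀ q ∈ (Metric.ball x r)ᶜ,
      JoinedByContinuumIn (Metric.ball x (r / l))ᶜ p q)

theorem IsLLC.exists_isLLCWith {X : Type*} [MetricSpace X] (h : IsLLC X) :
    ∃ l : ℝ, 1 ≤ l ∧ IsLLCWith l X := by
  obtain ⟨l, hl, h⟩ := h
  refine ⟨l, hl, fun x r hr => ⟨fun p hp q hq => ?_, fun p hp q hq => ?_⟩⟩
  · rcases eq_or_ne p q with rfl | hne
    · exact .refl (Metric.ball_subset_ball (le_mul_of_one_le_left hr.le hl) hp)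
    · exact (h x r hr).1 p hp q hq hne
  · rcases eq_or_ne p q with rfl | hne
    · exact .refl fun hp' => hp (Metric.ball_subset_ball (div_le_self hr.le hl) hp')
    · exact (h x r hr).2 p hp q hq hne

end Continua

/-! ### Two-dimensional Hausdorff measure under Lipschitz maps -/

section HausdorffTwo

variable {X : Type*} [MetricSpace X]

theorem hausdorffTwo_mono {S T : Set X} (h : S ⊆ T) : hausdorffTwo X S ≤ hausdorffTwo X T := by
  unfold hausdorffTwo
  gcongr

theorem hausdorffTwo_union_le (S T : Set X) :
    hausdorffTwo X (S ∪ T) ≤ hausdorffTwo X S + hausdorffTwo X T := by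
  unfold hausdorffTwo
  rw [← mul_add]
  gcongr
  exact MeasureTheory.measure_union_le _ _

theorem hausdorffTwo_biUnion_le {ι : Type*} (s : Finset ι) (f : ι → Set X) :
    hausdorffTwo X (⋃ i ∈ s, f i) ≤ ∑ i ∈ s, hausdorffTwo X (f i) := by
  unfold hausdorffTwo
  rw [← Finset.mul_sum]
  gcongr
  exact MeasureTheory.measure_biUnion_finset_le _ _

theorem hausdorffTwo_empty : hausdorffTwo X (∅ : Set X) = 0 := by
  simp [hausdorffTwo]

theorem LipschitzWith.hausdorffTwo_image_le {Z : Type*} [MetricSpace Z] {f : X → Z}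
    (hf : LipschitzWith 1 f) (S : Set X) : hausdorffTwo Z (f '' S) ≤ hausdorffTwo X S := by
  unfold hausdorffTwo
  gcongr
  let _ : MeasurableSpace X := borel X
  have : BorelSpace X := ⟨rfl⟩
  let _ : MeasurableSpace Z := borel Z
  have : BorelSpace Z := ⟨rfl⟩
  simpa using hf.hausdorffMeasure_image_le (d := 2) (by norm_num) S

theorem AntilipschitzWith.hausdorffTwo_le_image {Z : Type*} [MetricSpace Z] {f : X → Z}
    {L : ℝ≥0} (hf : AntilipschitzWith L f) (S : Set X) :
    hausdorffTwo X S ≤ (L : ℝ≥0∞) ^ 2 * hausdorffTwo Z (f '' S) := by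
  unfold hausdorffTwo
  rw [mul_left_comm]
  gcongr
  let _ : MeasurableSpace X := borel X
  have : BorelSpace X := ⟨rfl⟩
  let _ : MeasurableSpace Z := borel Z
  have : BorelSpace Z := ⟨rfl⟩
  simpa using hf.le_hausdorffMeasure_image (d := 2) (by norm_num) S

end HausdorffTwo

/-! ### Mass bounds beyond the diameter -/

section Regularity

variable {X : Type*} [MetricSpace X] [CompactSpace X] [Nontrivial X]

theorem diam_univ_pos : 0 < Metric.diam (Set.univ : Set X) := by
  obtain ⟨x, y, hxy⟩ := exists_pair_ne X
  exact (dist_pos.2 hxy).trans_le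
    (Metric.dist_le_diam_of_mem isCompact_univ.isBounded (Set.mem_univ x) (Set.mem_univ y))

theorem ofReal_lt_ediam_of_lt_diam {r : ℝ} (hr : r < Metric.diam (Set.univ : Set X)) :
    ENNReal.ofReal r < Metric.ediam (Set.univ : Set X) := by
  have h := ENNReal.ofReal_toReal (isCompact_univ (X := X)).isBounded.ediam_ne_top
  rw [← h]
  exact (ENNReal.ofReal_lt_ofReal_iff diam_univ_pos).2 hr

/-- In a compact Ahlfors regular space the upper mass bound holds for all radii. -/
theorem IsAhlforsTwoRegular.exists_upper_bound (h : IsAhlforsTwoRegular X) :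
    ∃ C : ℝ, 0 < C ∧ ∀ (x : X) (r : ℝ), 0 < r →
      hausdorffTwo X (Metric.ball x r) ≤ ENNReal.ofReal (C * r ^ 2) := by
  obtain ⟨K, hK, h⟩ := h
  set D := Metric.diam (Set.univ : Set X) with hD
  have hD0 : 0 < D := diam_univ_pos
  -- Finitely many balls of radius `D / 2 < D` cover the space, and each has finite measure.
  have hfin : hausdorffTwo X Set.univ ≠ ⊤ := by
    obtain ⟨t, -, ht, hcov⟩ := (isCompact_univ (X := X)).finite_cover_balls (half_pos hD0)
    lift t to Finset X using ht
    refine ne_top_of_le_ne_top ?_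
      ((hausdorffTwo_mono hcov).trans (hausdorffTwo_biUnion_le t _))
    refine ENNReal.sum_ne_top.2 fun x _ => ?_
    exact ne_top_of_le_ne_top ENNReal.ofReal_ne_top
      (h x (D / 2) (half_pos hD0) (ofReal_lt_ediam_of_lt_diam (half_lt_self hD0))).2
  set T := (hausdorffTwo X Set.univ).toReal with hT
  have hT0 : 0 ≤ T := ENNReal.toReal_nonneg
  refine ⟨K + T / D ^ 2, by positivity, fun x r hr => ?_⟩
  rcases lt_or_ge r D with hrD | hrD
  · refine (h x r hr (ofReal_lt_ediam_of_lt_diam hrD)).2.trans (ENNReal.ofReal_le_ofReal ?_)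
    gcongr
    exact le_add_of_nonneg_right (by positivity)
  · refine (hausdorffTwo_mono (Set.subset_univ _)).trans ?_
    rw [← ENNReal.ofReal_toReal hfin]
    refine ENNReal.ofReal_le_ofReal ?_
    calc T = T / D ^ 2 * D ^ 2 := by field_simp
      _ ≤ (K + T / D ^ 2) * r ^ 2 := by
        gcongr
        exact le_add_of_nonneg_left hK.le

/-- In a compact Ahlfors regular space the lower mass bound holds for all bounded radii. -/
theorem IsAhlforsTwoRegular.exists_lower_bound (h : IsAhlforsTwoRegular X) {R : ℝ}
    (hR : 0 ≤ R) :
    ∃ c : ℝ, 0 < c ∧ ∀ (x : X) (r : ℝ), 0 < r → r ≤ R →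
      ENNReal.ofReal (c * r ^ 2) ≤ hausdorffTwo X (Metric.ball x r) := by
  obtain ⟨K, hK, h⟩ := h
  set D := Metric.diam (Set.univ : Set X) with hD
  have hD0 : 0 < D := diam_univ_pos
  -- This factor brings every radius up to `R`, which may exceed `D`, strictly below `D`.
  set t := D / (R + D) / 2 with ht
  have ht0 : 0 < t := by positivity
  have ht1 : t ≤ 1 := by
    rw [ht, div_div, div_le_one (by positivity)]
    nlinarith
  refine ⟨K⁻¹ * t ^ 2, by positivity, fun x r hr hrR => ?_⟩
  have htr : t * r < D := by
    rw [ht, div_div, div_mul_eq_mul_div, div_lt_iff₀ (by positivity)]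
    nlinarith
  rw [mul_assoc, ← mul_pow]
  exact (h x (t * r) (by positivity) (ofReal_lt_ediam_of_lt_diam htr)).1.trans
    (hausdorffTwo_mono (Metric.ball_subset_ball (mul_le_of_le_one_left hr.le ht1)))

end Regularity

/-! ### Regularity and LLC of bilipschitz gluings -/

/-- The space `Z` is covered by bilipschitz images of `X` and `Y`, and up to the factor `L` every
distance between points of different pieces is realized through a common point of the pieces. -/
structure IsBilipschitzGluing {X Y Z : Type*} [MetricSpace X] [MetricSpace Y] [MetricSpace Z]
    (L : ℝ≥0) (i : X → Z) (j : Y → Z) : Prop where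
  one_le : 1 ≤ L
  left_lipschitz : LipschitzWith 1 i
  left_antilipschitz : AntilipschitzWith L i
  right_lipschitz : LipschitzWith 1 j
  right_antilipschitz : AntilipschitzWith L j
  cover : Set.range i ∪ Set.range j = Set.univ
  cross : ∀ x y, ∃ a b, i a = j b ∧ dist x a + dist b y ≤ L * dist (i x) (j y)
  nontrivial : (Set.range i ∩ Set.range j).Nontrivial

namespace IsBilipschitzGluing

variable {X Y Z : Type*} [MetricSpace X] [MetricSpace Y] [MetricSpace Z]
  {L : ℝ≥0} {i : X → Z} {j : Y → Z}

theorem symm (h : IsBilipschitzGluing L i j) : IsBilipschitzGluing L j i where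
  one_le := h.one_le
  left_lipschitz := h.right_lipschitz
  left_antilipschitz := h.right_antilipschitz
  right_lipschitz := h.left_lipschitz
  right_antilipschitz := h.left_antilipschitz
  cover := by rw [Set.union_comm, h.cover]
  cross y x := by
    obtain ⟨a, b, hab, hle⟩ := h.cross x y
    refine ⟨b, a, hab.symm, ?_⟩
    rw [dist_comm y b, dist_comm a x, add_comm, dist_comm (j y)]
    exact hle
  nontrivial := by rw [Set.inter_comm]; exact h.nontrivial

theorem one_le_real (h : IsBilipschitzGluing L i j) : (1 : ℝ) ≤ L := by exact_mod_cast h.one_le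

theorem exists_eq (h : IsBilipschitzGluing L i j) (z : Z) : (∃ x, i x = z) ∨ ∃ y, j y = z :=
  h.cover.symm.subset (Set.mem_univ z)

theorem dist_map_le (h : IsBilipschitzGluing L i j) (x x' : X) : dist (i x) (i x') ≤ dist x x' := by
  simpa using h.left_lipschitz.dist_le_mul x x'

theorem le_mul_dist_map (h : IsBilipschitzGluing L i j) (x x' : X) :
    dist x x' ≤ L * dist (i x) (i x') :=
  h.left_antilipschitz.le_mul_dist x x'

theorem compactSpace [CompactSpace X] [CompactSpace Y] (h : IsBilipschitzGluing L i j) :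
    CompactSpace Z := by
  rw [← isCompact_univ_iff, ← h.cover]
  exact (isCompact_range h.left_lipschitz.continuous).union
    (isCompact_range h.right_lipschitz.continuous)

theorem nontrivial_left (h : IsBilipschitzGluing L i j) : Nontrivial X := by
  obtain ⟨_, ⟨⟨x, rfl⟩, -⟩, _, ⟨⟨x', rfl⟩, -⟩, hne⟩ := h.nontrivial
  exact ⟨x, x', fun e => hne (congrArg i e)⟩

/-- The centre `z` may lie in the other piece, so the ball is recentred at a point of its
intersection with the range of `i`. Points of the ball are less than `2 * r` apart, and pulling back
to `X` costs a factor `L`. -/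
theorem hausdorffTwo_left_part_le (h : IsBilipschitzGluing L i j) {C : ℝ}
    (hC : ∀ (x : X) (r : ℝ), 0 < r →
      hausdorffTwo X (Metric.ball x r) ≤ ENNReal.ofReal (C * r ^ 2)) (z : Z) {r : ℝ} (hr : 0 < r) :
    hausdorffTwo Z (Metric.ball z r ∩ Set.range i) ≤ ENNReal.ofReal (C * (L * (2 * r)) ^ 2) := by
  have hL : (1 : ℝ) ≤ L := h.one_le_real
  rcases Set.eq_empty_or_nonempty (Metric.ball z r ∩ Set.range i) with he | ⟨_, hx, x, rfl⟩
  · rw [he, hausdorffTwo_empty]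
    exact zero_le
  · refine le_trans (hausdorffTwo_mono ?_) ((h.left_lipschitz.hausdorffTwo_image_le _).trans
      (hC x (L * (2 * r)) (by positivity)))
    rintro _ ⟨hx', x', rfl⟩
    refine ⟨x', ?_, rfl⟩
    rw [Metric.mem_ball] at hx hx' ⊢
    refine (h.le_mul_dist_map x' x).trans_lt ?_
    have := dist_triangle_right (i x') (i x) z
    gcongr
    linarith

theorem le_hausdorffTwo_ball (h : IsBilipschitzGluing L i j) {c R : ℝ}
    (hc : ∀ (x : X) (r : ℝ), 0 < r → r ≤ R →
      ENNReal.ofReal (c * r ^ 2) ≤ hausdorffTwo X (Metric.ball x r)) (x : X) {r : ℝ} (hr : 0 < r)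
    (hrR : r ≤ R) :
    ENNReal.ofReal (c / L ^ 2 * r ^ 2) ≤ hausdorffTwo Z (Metric.ball (i x) r) := by
  have hL : (1 : ℝ) ≤ L := h.one_le_real
  have hL0 : (L : ℝ≥0∞) ^ 2 ≠ 0 :=
    pow_ne_zero _ (by exact_mod_cast (zero_lt_one.trans_le h.one_le).ne')
  have hsub : i '' Metric.ball x r ⊆ Metric.ball (i x) r := by
    rintro _ ⟨x', hx', rfl⟩
    exact (h.dist_map_le x' x).trans_lt hx'
  have h1 := (hc x r hr hrR).trans ((h.left_antilipschitz.hausdorffTwo_le_image _).trans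
    (mul_le_mul_right (hausdorffTwo_mono hsub) _))
  rw [div_mul_eq_mul_div, ENNReal.ofReal_div_of_pos (by positivity)]
  refine ENNReal.div_le_of_le_mul' ?_
  rwa [ENNReal.ofReal_pow (by positivity), ENNReal.ofReal_coe_nnreal]

theorem isAhlforsTwoRegular [CompactSpace X] [CompactSpace Y] (h : IsBilipschitzGluing L i j)
    (hX : IsAhlforsTwoRegular X) (hY : IsAhlforsTwoRegular Y) : IsAhlforsTwoRegular Z := by
  have := h.compactSpace
  have := h.nontrivial_left
  have := h.symm.nontrivial_left
  have hL : (1 : ℝ) ≤ L := h.one_le_real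
  set R := Metric.diam (Set.univ : Set Z) with hR
  have hR0 : 0 ≤ R := Metric.diam_nonneg
  obtain ⟨C, hC0, hC⟩ := hX.exists_upper_bound
  obtain ⟨C', hC0', hC'⟩ := hY.exists_upper_bound
  obtain ⟨c, hc0, hc⟩ := hX.exists_lower_bound hR0
  obtain ⟨c', hc0', hc'⟩ := hY.exists_lower_bound hR0
  -- The first summand gives the upper mass bound; the other two give the lower bound at centres in
  -- either piece.
  set K := 4 * L ^ 2 * (C + C') + L ^ 2 / c + L ^ 2 / c' with hK
  have hc1 : 0 < L ^ 2 / c := by positivity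
  have hc2 : 0 < L ^ 2 / c' := by positivity
  have hc3 : 0 < 4 * L ^ 2 * (C + C') := by positivity
  have hK0 : 0 < K := by positivity
  refine ⟨K, hK0, fun z r hr hrd => ⟨?_, ?_⟩⟩
  · have hrR : r ≤ R := by
      rw [← ENNReal.ofReal_toReal (isCompact_univ (X := Z)).isBounded.ediam_ne_top] at hrd
      exact (ENNReal.ofReal_le_ofReal_iff hR0).1 hrd.le
    rcases h.exists_eq z with ⟨x, rfl⟩ | ⟨y, rfl⟩
    · refine le_trans (ENNReal.ofReal_le_ofReal ?_) (h.le_hausdorffTwo_ball hc x hr hrR)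
      gcongr
      rw [← inv_div (L ^ 2 : ℝ) c]
      exact inv_anti₀ hc1 (by linarith)
    · refine le_trans (ENNReal.ofReal_le_ofReal ?_) (h.symm.le_hausdorffTwo_ball hc' y hr hrR)
      gcongr
      rw [← inv_div (L ^ 2 : ℝ) c']
      exact inv_anti₀ hc2 (by linarith)
  · have hsub : Metric.ball z r ⊆
        Metric.ball z r ∩ Set.range i ∪ Metric.ball z r ∩ Set.range j := by
      rw [← Set.inter_union_distrib_left, h.cover, Set.inter_univ]
    refine (hausdorffTwo_mono hsub).trans ((hausdorffTwo_union_le _ _).trans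
      ((add_le_add (h.hausdorffTwo_left_part_le hC z hr)
        (h.symm.hausdorffTwo_left_part_le hC' z hr)).trans ?_))
    rw [← ENNReal.ofReal_add (by positivity) (by positivity)]
    refine ENNReal.ofReal_le_ofReal ?_
    calc C * (L * (2 * r)) ^ 2 + C' * (L * (2 * r)) ^ 2 = 4 * L ^ 2 * (C + C') * r ^ 2 := by ring
      _ ≤ K * r ^ 2 := by
        gcongr
        linarith

/-- If `w` lies in the other piece, the continuum passes through a common point at distance less
than `L * r` from both ends. Its second half then stays within `(l' + 1) * L * r` of the centre. The
constant is symmetric in `l` and `l'`, so it also serves centres in the other piece. -/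
theorem joined_center_in_ball (h : IsBilipschitzGluing L i j) {l l' : ℝ} (hl : 1 ≤ l)
    (hl' : 1 ≤ l') (hX : IsLLCWith l X) (hY : IsLLCWith l' Y) (x : X) {r : ℝ} (hr : 0 < r) {w : Z}
    (hw : w ∈ Metric.ball (i x) r) :
    JoinedByContinuumIn (Metric.ball (i x) ((l + l' + 1) * L * r)) (i x) w := by
  have hL : (1 : ℝ) ≤ L := h.one_le_real
  have hLr : 0 < L * r := by positivity
  have hX' : ∀ p, dist x p < L * r →
      JoinedByContinuumIn (Metric.ball (i x) ((l + l' + 1) * L * r)) (i x) (i p) := by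
    intro p hp
    refine ((hX x (L * r) hLr).1 x (Metric.mem_ball_self hLr) p
      (by rwa [Metric.mem_ball'])).image h.left_lipschitz.continuous fun e he => ?_
    rw [Metric.mem_ball] at he ⊢
    refine (h.dist_map_le e x).trans_lt (he.trans_le ?_)
    nlinarith
  rw [Metric.mem_ball'] at hw
  rcases h.exists_eq w with ⟨p, rfl⟩ | ⟨q, rfl⟩
  · refine hX' p ((h.le_mul_dist_map x p).trans_lt ?_)
    gcongr
  · obtain ⟨a, b, hab, hle⟩ := h.cross x q
    have hlt : dist x a + dist b q < L * r := hle.trans_lt (by gcongr)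
    have hxa : dist x a < L * r := by linarith [dist_nonneg (x := b) (y := q)]
    have hbq : dist b q < L * r := by linarith [dist_nonneg (x := x) (y := a)]
    refine (hX' a hxa).trans ?_
    rw [hab]
    refine ((hY b (L * r) hLr).1 b (Metric.mem_ball_self hLr) q
      (by rwa [Metric.mem_ball'])).image h.right_lipschitz.continuous fun e he => ?_
    rw [Metric.mem_ball] at he ⊢
    have h1 := dist_triangle (j e) (j b) (i x)
    have h2 := h.symm.dist_map_le e b
    have h3 := h.dist_map_le a x
    rw [hab, dist_comm a x] at h3
    nlinarith

/-- Points outside of a ball can be joined to glued points outside of that ball. -/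
theorem joined_common_in_compl_ball [CompactSpace Y] [ConnectedSpace Y]
    (h : IsBilipschitzGluing L i j) {l l' : ℝ}
    (hl : 1 ≤ l) (hl' : 1 ≤ l') (hX : IsLLCWith l X) (hY : IsLLCWith l' Y) (x : X) {s : ℝ}
    (hs : 0 < s) {w g : Z} (hw : w ∉ Metric.ball (i x) s) (hg : g ∉ Metric.ball (i x) s)
    (hgi : g ∈ Set.range i) (hgj : g ∈ Set.range j) :
    JoinedByContinuumIn (Metric.ball (i x) (s / (4 * l * l' * L ^ 2)))ᶜ w g := by
  have hL : (1 : ℝ) ≤ L := h.one_le_real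
  have hll' : 1 ≤ l * l' := one_le_mul_of_one_le_of_one_le hl hl'
  have hLL : (L : ℝ) ≤ L ^ 2 := le_self_pow₀ hL two_ne_zero
  rw [Metric.mem_ball', not_lt] at hw hg
  rcases h.exists_eq w with ⟨p, rfl⟩ | ⟨q, rfl⟩
  · obtain ⟨a, rfl⟩ := hgi
    refine ((hX x s hs).2 p ?_ a ?_).image h.left_lipschitz.continuous fun e he => ?_
    · rw [Set.mem_compl_iff, Metric.mem_ball', not_lt]
      exact hw.trans (h.dist_map_le x p)
    · rw [Set.mem_compl_iff, Metric.mem_ball', not_lt]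
      exact hg.trans (h.dist_map_le x a)
    · rw [Set.mem_compl_iff, Metric.mem_ball', not_lt] at he ⊢
      have h1 := he.trans (h.le_mul_dist_map x e)
      rw [div_le_iff₀ (by positivity)] at h1
      rw [div_le_iff₀ (by positivity)]
      refine h1.trans ?_
      have : l * L ≤ 4 * l * l' * L ^ 2 := by
        calc l * L = 1 * l * 1 * L := by ring
          _ ≤ 4 * l * l' * L ^ 2 := by gcongr; norm_num
      nlinarith [dist_nonneg (x := i x) (y := i e)]
  · obtain ⟨b, rfl⟩ := hgj
    -- Both points now lie in the piece opposite to the centre. If a common point is close to `x`,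
    -- it replaces `x` as the centre of a ball in `Y`; otherwise the whole of `Y` is far from `i x`.
    by_cases hnear : ∃ a₀ b₀, i a₀ = j b₀ ∧ dist x a₀ < s / (4 * l' * L)
    · obtain ⟨a₀, b₀, hab, hxa⟩ := hnear
      have hsmall : s / (4 * l' * L) ≤ s / 2 := by
        gcongr
        nlinarith
      have hxa' := h.dist_map_le x a₀
      have far : ∀ y, s ≤ dist (i x) (j y) → y ∈ (Metric.ball b₀ (s / 2))ᶜ := by
        intro y hy
        rw [Set.mem_compl_iff, Metric.mem_ball', not_lt]
        have h1 := dist_triangle (i x) (i a₀) (j y)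
        have h2 := h.symm.dist_map_le b₀ y
        rw [← hab] at h2
        linarith
      refine ((hY b₀ (s / 2) (half_pos hs)).2 q (far q hw) b (far b hg)).image
        h.right_lipschitz.continuous fun e he => ?_
      rw [Set.mem_compl_iff, Metric.mem_ball', not_lt] at he ⊢
      have h1 := he.trans (h.symm.le_mul_dist_map b₀ e)
      -- This is twice the threshold in `hnear`, so half of it survives the return from `j b₀` to `i
      -- x`.
      have h2 : s / (2 * l' * L) ≤ dist (j b₀) (j e) := by
        rw [div_div, div_le_iff₀ (by positivity)] at h1
        rw [div_le_iff₀ (by positivity)]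
        linarith
      have h3 := dist_triangle_left (j b₀) (j e) (i x)
      rw [← hab] at h2 h3
      have h4 : s / (2 * l' * L) = 2 * (s / (4 * l' * L)) := by
        field_simp
        norm_num
      have h5 : s / (4 * l * l' * L ^ 2) ≤ s / (4 * l' * L) := by
        refine div_le_div_of_nonneg_left hs.le (by positivity) ?_
        calc 4 * l' * L = 4 * 1 * l' * L := by ring
          _ ≤ 4 * l * l' * L ^ 2 := by gcongr
      linarith
    · push Not at hnear
      -- The continuum is all of `Y`: reaching it from `x` means crossing at a distant common point.
      -- The estimate in `cross` costs the second factor `L` in the constant.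
      refine JoinedByContinuumIn.image (S := Set.univ)
        ⟨Set.univ, isCompact_univ, isConnected_univ, Set.mem_univ q, Set.mem_univ b, subset_rfl⟩
        h.right_lipschitz.continuous fun e _ => ?_
      rw [Set.mem_compl_iff, Metric.mem_ball', not_lt]
      obtain ⟨a₀, b₀, hab, hle⟩ := h.cross x e
      have h1 : s / (4 * l' * L) ≤ L * dist (i x) (j e) :=
        (hnear a₀ b₀ hab).trans (le_trans (by linarith [dist_nonneg (x := b₀) (y := e)]) hle)
      rw [div_le_iff₀ (by positivity)] at h1 ⊢
      refine h1.trans ?_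
      have : 4 * l' * L ^ 2 ≤ 4 * l * l' * L ^ 2 := by
        calc 4 * l' * (L : ℝ) ^ 2 = 4 * 1 * l' * L ^ 2 := by ring
          _ ≤ 4 * l * l' * L ^ 2 := by gcongr
      nlinarith [dist_nonneg (x := i x) (y := j e)]

theorem isLLC [CompactSpace X] [ConnectedSpace X] [CompactSpace Y] [ConnectedSpace Y]
    (h : IsBilipschitzGluing L i j) (hX : IsLLC X) (hY : IsLLC Y) : IsLLC Z := by
  have := h.compactSpace
  have hL : (1 : ℝ) ≤ L := h.one_le_real
  obtain ⟨l, hl, hX⟩ := hX.exists_isLLCWith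
  obtain ⟨l', hl', hY⟩ := hY.exists_isLLCWith
  obtain ⟨g₁, hg₁, g₂, hg₂, hne⟩ := h.nontrivial
  set R := Metric.diam (Set.univ : Set Z) with hR
  have hdR : ∀ z w : Z, dist z w ≤ R := fun z w =>
    Metric.dist_le_diam_of_mem isCompact_univ.isBounded (Set.mem_univ z) (Set.mem_univ w)
  have hd0 : 0 < dist g₁ g₂ := dist_pos.2 hne
  have hR0 : 0 < R := hd0.trans_le (hdR g₁ g₂)
  -- For `r ≤ R` a ball of radius `κ * r` has diameter too small to contain both `g₁` and `g₂`.
  set κ := dist g₁ g₂ / (2 * R) with hκ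
  have hκ0 : 0 < κ := by positivity
  have hκ1 : κ ≤ 1 := by
    rw [hκ, div_le_one (by positivity)]
    linarith [hdR g₁ g₂]
  set C := 4 * l * l' * (L : ℝ) ^ 2 with hC
  have hC1 : 1 ≤ C := by
    calc (1 : ℝ) = 1 * 1 * 1 * 1 ^ 2 := by norm_num
      _ ≤ C := by rw [hC]; gcongr; norm_num
  -- The first summand serves the inside condition, the second the outside one.
  set lam := (l + l' + 1) * L + C / κ with hlam
  have hlam1 : 1 ≤ lam := by
    have : 1 ≤ C / κ := (one_le_div hκ0).2 (hκ1.trans hC1)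
    have : 0 ≤ (l + l' + 1) * L := by positivity
    linarith
  refine ⟨lam, hlam1, fun z r hr => ⟨fun p hp q hq _ => ?_, fun p hp q hq _ => ?_⟩⟩
  · have key : ∀ w ∈ Metric.ball z r, JoinedByContinuumIn (Metric.ball z (lam * r)) z w := by
      intro w hw
      have hle : (l + l' + 1) * L * r ≤ lam * r := by
        gcongr
        exact le_add_of_nonneg_right (by positivity)
      rcases h.exists_eq z with ⟨x, rfl⟩ | ⟨y, rfl⟩
      · exact (h.joined_center_in_ball hl hl' hX hY x hr hw).mono (Metric.ball_subset_ball hle)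
      · refine (h.symm.joined_center_in_ball hl' hl hY hX y hr hw).mono
          (Metric.ball_subset_ball ?_)
        rwa [add_comm l' l]
    exact (key p hp).symm.trans (key q hq)
  -- A point outside the ball exists, so the radius cannot exceed the diameter.
  · have hrR : r ≤ R := by
      rw [Set.mem_compl_iff, Metric.mem_ball, not_lt] at hp
      exact hp.trans (hdR p z)
    have hs : 0 < κ * r := by positivity
    have hκr : κ * r ≤ dist g₁ g₂ / 2 := by
      calc κ * r ≤ κ * R := by gcongr
        _ = dist g₁ g₂ / 2 := by rw [hκ]; field_simp
    obtain ⟨g, ⟨hgi, hgj⟩, hg⟩ : ∃ g ∈ Set.range i ∩ Set.range j, g ∉ Metric.ball z (κ * r) := by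
      by_contra! hcon
      have h1 := Metric.mem_ball.1 (hcon g₁ hg₁)
      have h2 := Metric.mem_ball.1 (hcon g₂ hg₂)
      linarith [dist_triangle_right g₁ g₂ z]
    have hsub : Metric.ball z (κ * r) ⊆ Metric.ball z r :=
      Metric.ball_subset_ball (mul_le_of_le_one_left hr.le hκ1)
    have hrad : r / lam ≤ κ * r / C := by
      calc r / lam ≤ r / (C / κ) := by
            gcongr
            exact le_add_of_nonneg_left (by positivity)
        _ = κ * r / C := by field_simp
    have key : ∀ w ∈ (Metric.ball z r)ᶜ, JoinedByContinuumIn (Metric.ball z (r / lam))ᶜ w g := by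
      intro w hw
      refine JoinedByContinuumIn.mono (S := (Metric.ball z (κ * r / C))ᶜ) ?_
        (Set.compl_subset_compl.2 (Metric.ball_subset_ball hrad))
      have hw' : w ∉ Metric.ball z (κ * r) := fun hmem => hw (hsub hmem)
      rcases h.exists_eq z with ⟨x, rfl⟩ | ⟨y, rfl⟩
      · exact h.joined_common_in_compl_ball hl hl' hX hY x hs hw' hg hgi hgj
      · have := h.symm.joined_common_in_compl_ball hl' hl hY hX y hs hw' hg hgj hgi
        rwa [show 4 * l' * l * (L : ℝ) ^ 2 = C by rw [hC]; ring] at this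
    exact (key p hp).trans (key q hq).symm

end IsBilipschitzGluing

/-! ### The glued space is a bilipschitz gluing -/

theorem dist_le_mul_of_edist_le {L : ℝ≥0} {U V W : Type*} [PseudoMetricSpace U]
    [PseudoMetricSpace V] [PseudoMetricSpace W] {v v' : V} {u u' : U} {w w' : W}
    (h : edist v v' + edist u u' ≤ L * edist w w') : dist v v' + dist u u' ≤ L * dist w w' := by
  simpa [dist_edist, ENNReal.toReal_add (edist_ne_top v v') (edist_ne_top u u')] using
    ENNReal.toReal_mono (ENNReal.mul_ne_top ENNReal.coe_ne_top (edist_ne_top w w')) h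

theorem isBilipschitzGluing_gluedSpace {X Y : Type*} [MetricSpace X] [MetricSpace Y]
    {A : Set X} {B : Set Y} {γ : A → B} {L : ℝ≥0} (hL : 1 ≤ L) (hγ : AntilipschitzWith L γ)
    (hγ' : LipschitzWith L γ) (hA : IsCompact A) (hA' : A.Nontrivial) :
    letI := gluedMetricSpace hL hγ hγ' hA hA'.nonempty
    IsBilipschitzGluing L (fun x : X => GluedSpace.mk γ (Sum.inl x))
      (fun y : Y => GluedSpace.mk γ (Sum.inr y)) := by
  let _ := gluedMetricSpace hL hγ hγ' hA hA'.nonempty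
  have hleft : AntilipschitzWith L (fun x : X => GluedSpace.mk γ (Sum.inl x)) :=
    edist_le_mul_quotientEDist_inl hL hγ
  refine
    { one_le := hL
      left_lipschitz := fun x x' => ?_
      left_antilipschitz := hleft
      right_lipschitz := fun y y' => ?_
      right_antilipschitz := edist_le_mul_quotientEDist_inr hL hγ'
      cover := ?_
      cross := fun x y => ?_
      nontrivial := ?_ }
  · rw [ENNReal.coe_one, one_mul]
    exact quotientEDist_mk_le γ (Sum.inl x) (Sum.inl x')
  · rw [ENNReal.coe_one, one_mul]
    exact quotientEDist_mk_le γ (Sum.inr y) (Sum.inr y')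
  · refine Set.eq_univ_of_forall fun z => ?_
    obtain ⟨s | s, rfl⟩ := GluedSpace.mk_surjective γ z
    · exact .inl ⟨s, rfl⟩
    · exact .inr ⟨s, rfl⟩
  · obtain ⟨a, ha⟩ := exists_edist_add_edist_le hL hγ hγ'.continuous hA hA'.nonempty x y
    exact ⟨a, γ a, GluedSpace.mk_inl_eq_mk_inr γ a, dist_le_mul_of_edist_le ha⟩
  · obtain ⟨a, ha, a', ha', hne⟩ := hA'
    have hcommon : ∀ a : A, GluedSpace.mk γ (Sum.inl (a : X)) ∈
        Set.range (fun x : X => GluedSpace.mk γ (Sum.inl x)) ∩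
          Set.range (fun y : Y => GluedSpace.mk γ (Sum.inr y)) := fun a =>
      ⟨⟨a, rfl⟩, γ a, (GluedSpace.mk_inl_eq_mk_inr γ a).symm⟩
    exact ⟨_, hcommon ⟨a, ha⟩, _, hcommon ⟨a', ha'⟩, fun h => hne (hleft.injective h)⟩

theorem lemma3p5
    {X Y : Type*} [MetricSpace X] [MetricSpace Y]
    -- `X` and `Y` are homeomorphic to compact connected smooth surfaces `M` and `N`
    {M N : Type*}
    [TopologicalSpace M] [ChartedSpace (EuclideanHalfSpace 2) M] [IsManifold (𝓡∂ 2) ∞ M]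
    [CompactSpace M] [ConnectedSpace M]
    [TopologicalSpace N] [ChartedSpace (EuclideanHalfSpace 2) N] [IsManifold (𝓡∂ 2) ∞ N]
    [CompactSpace N] [ConnectedSpace N]
    (φ : X ≃ₜ M) (ψ : Y ≃ₜ N)
    -- boundary components and a biLipschitz homeomorphism between them
    (A : Set X) (hA : IsComponentOf A (surfaceBoundary φ))
    (B : Set Y) (hB : IsComponentOf B (surfaceBoundary ψ))
    (γ : A ≃ₜ B)
    (hγ : ∃ L : ℝ≥0, LipschitzWith L γ ∧ AntilipschitzWith L γ)
    (hXreg : IsAhlforsTwoRegular X) (hXllc : IsLLC X)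
    (hYreg : IsAhlforsTwoRegular Y) (hYllc : IsLLC Y) :
    -- the quotient semi-metric is a metric, with which the glued space is regular and LLC
    ∃ m : MetricSpace (GluedSpace γ),
      (∀ a b : GluedSpace γ, edist a b = quotientEDist γ a b) ∧
        IsAhlforsTwoRegular (GluedSpace γ) ∧ IsLLC (GluedSpace γ) := by
  obtain ⟨L₀, hLip, hAnti⟩ := hγ
  have : CompactSpace X := φ.symm.compactSpace
  have : CompactSpace Y := ψ.symm.compactSpace
  have : ConnectedSpace X := φ.symm.surjective.connectedSpace φ.symm.continuous
  have : ConnectedSpace Y := ψ.symm.surjective.connectedSpace ψ.symm.continuous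
  -- A constant at least `1` is needed so that division by it does not increase distances.
  have hL : 1 ≤ max L₀ 1 := le_max_right _ _
  have hLip' : LipschitzWith (max L₀ 1) γ := hLip.weaken (le_max_left _ _)
  have hAnti' : AntilipschitzWith (max L₀ 1) γ := fun a a' =>
    (hAnti a a').trans (by gcongr; exact le_max_left _ _)
  have hAc : IsCompact A := (hA.isClosed_of_surfaceBoundary φ).isCompact
  have hAn : A.Nontrivial := hA.nontrivial_of_surfaceBoundary φ
  let _ := gluedMetricSpace hL hAnti' hLip' hAc hAn.nonempty
  have h := isBilipschitzGluing_gluedSpace hL hAnti' hLip' hAc hAn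
  exact ⟨inferInstance, gluedMetricSpace_edist hL hAnti' hLip' hAc hAn.nonempty,
    h.isAhlforsTwoRegular hXreg hYreg, h.isLLC hXllc hYllc⟩
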